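/- \textbf{Theorem (strong maximum principle, regional case).} Let $N\ge 1$ and let $j:\mathbb{R}^N\to[0,\infty]$ be a function such that (j1) $j$ is even and measurable with $\int_{\mathbb{R}^N}(1\wedge|z|^2)\,j(z)\,dz<\infty$; (j2) for every $r>0$, $j$ does not vanish a.e. in $B_r(0)$. Let $\Omega\subset\mathbb{R}^N$ be a domain (nonempty, open and connected), let $c\in L^\infty_{loc}(\Omega)$, and let $u$ belong to $$\mathcal{H}^j_{loc}(\Omega):=\Bigl\{u\in L^2_{loc}(\overline{\Omega}) : \int_{\Omega'}\int_{\Omega}(u(x)-u(y))^2 j(x-y)\,dx\,dy<\infty\ \text{ for every } \Omega'\subset\subset\Omega\Bigr\},$$ where $\Omega'\subset\subset\Omega$ means that $\Omega'$ is measurable and $\overline{\Omega'}$ is compact and contained in $\Omega$, and where $u\in L^2_{loc}(\overline{\Omega})$ means that $u\in L^2(\Omega\cap K)$ for every compact $K\subset\mathbb{R}^N$. Suppose that $u$ is a weak supersolution of the regional equation $I_\Omega u=c(x)u$ in $\Omega$, where formally $I_\Omega u(x)=P.V.\int_\Omega (u(x)-u(y))j(x-y)\,dy$, i.e. $$\int_{\Omega}\int_{\Omega}(u(x)-u(y))(\varphi(x)-\varphi(y))\,j(x-y)\,dx\,dy\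 \ge\ \int_{\Omega}c(x)\,u(x)\,\varphi(x)\,dx\qquad\text{for all }\varphi\in C_c^\infty(\Omega),\ \varphi\ge 0,$$ and that $u\ge 0$ a.e. in $\Omega$. Then either $u=0$ a.e. in $\Omega$, or $u$ is strictly positive in $\Omega$, in the sense that $\operatorname{ess\,inf}_K u>0$ for every compact subset $K\subset\Omega$. -/

import Mathlib

open MeasureTheory Set
open scoped ENNReal ContDiff

namespace RegionalSMP

/-- `V ⊂⊂ U`: the closure of `V` is compact and contained in the interior of `U`. -/
def CompactlyContained {N : ℕ} (V U : Set (EuclideanSpace ℝ (Fin N))) : Prop :=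
  IsCompact (closure V) ∧ closure V ⊆ interior U

/-- Condition (j1): the kernel `j : ℝ^N → [0,∞]` is (Lebesgue) measurable and even, and
`∫ (1 ∧ |z|²) j(z) dz < ∞`. -/
structure LevyKernel {N : ℕ} (j : EuclideanSpace ℝ (Fin N) → ℝ≥0∞) : Prop where
  aemeasurable : AEMeasurable j volume
  even : ∀ z, j (-z) = j z
  integrability : ∫⁻ z, ENNReal.ofReal (min 1 (‖z‖ ^ 2)) * j z < ⊤

/-- Condition (j2): for every `r > 0`, `j` does not vanish a.e. in `B_r(0)`. -/
def NontrivialNearZero {N : ℕ} (j : EuclideanSpace ℝ (Fin N) → ℝ≥0∞) : Prop :=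
  ∀ r : ℝ, 0 < r → ¬ (∀ᵐ z ∂(volume.restrict (Metric.ball 0 r)), j z = 0)

/-- `c ∈ L^∞_loc(Ω)`. -/
def MemLinftyLoc {N : ℕ} (Ω : Set (EuclideanSpace ℝ (Fin N)))
    (c : EuclideanSpace ℝ (Fin N) → ℝ) : Prop :=
  ∀ K : Set (EuclideanSpace ℝ (Fin N)), IsCompact K → K ⊆ Ω → MemLp c ⊤ (volume.restrict K)

/-- `u ∈ L²_loc(closure Ω)` for a function `u` on `Ω` (its values off `Ω` play no role):
`u` is square integrable on the part of `Ω` in any compact set of `ℝ^N`, so up to the boundary. -/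
def MemL2LocClosure {N : ℕ} (Ω : Set (EuclideanSpace ℝ (Fin N)))
    (u : EuclideanSpace ℝ (Fin N) → ℝ) : Prop :=
  ∀ K : Set (EuclideanSpace ℝ (Fin N)), IsCompact K → MemLp u 2 (volume.restrict (K ∩ Ω))

/-- The space `H^j_loc(Ω)`: functions `u ∈ L²_loc(closure Ω)` such that
`∫_{Ω'} ∫_Ω (u(x) - u(y))² j(x - y) dx dy < ∞` for every `Ω' ⊂⊂ Ω`. -/
structure MemHLoc {N : ℕ} (j : EuclideanSpace ℝ (Fin N) → ℝ≥0∞)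
    (Ω : Set (EuclideanSpace ℝ (Fin N))) (u : EuclideanSpace ℝ (Fin N) → ℝ) : Prop where
  memL2Loc : MemL2LocClosure Ω u
  energy_lt_top : ∀ Ω' : Set (EuclideanSpace ℝ (Fin N)), MeasurableSet Ω' →
    CompactlyContained Ω' Ω →
    ∫⁻ p in Ω' ×ˢ Ω, ENNReal.ofReal ((u p.1 - u p.2) ^ 2) * j (p.1 - p.2) < ⊤

/-- The nonnegative functions in `C_c^∞(Ω)`. -/
structure IsNonnegTestFunction {N : ℕ} (Ω : Set (EuclideanSpace ℝ (Fin N)))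
    (φ : EuclideanSpace ℝ (Fin N) → ℝ) : Prop where
  smooth : ContDiff ℝ ∞ φ
  hasCompactSupport : HasCompactSupport φ
  tsupport_subset : tsupport φ ⊆ Ω
  nonneg : ∀ x, 0 ≤ φ x

/-- `∫_Ω ∫_Ω (u(x) - u(y)) (φ(x) - φ(y)) j(x - y) dx dy`, as a Lebesgue integral over `Ω × Ω`.
Under (j1) the kernel is finite a.e., and the integrand is absolutely integrable whenever
`u ∈ H^j_loc(Ω)` and `φ ∈ C_c^∞(Ω)`. -/
noncomputable def regionalForm {N : ℕ} (j : EuclideanSpace ℝ (Fin N) → ℝ≥0∞)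
    (Ω : Set (EuclideanSpace ℝ (Fin N))) (u φ : EuclideanSpace ℝ (Fin N) → ℝ) : ℝ :=
  ∫ p in Ω ×ˢ Ω, (u p.1 - u p.2) * (φ p.1 - φ p.2) * (j (p.1 - p.2)).toReal

/-- The inequality defining a weak supersolution of `I_Ω u = c(x) u` in `Ω`. -/
def IsRegionalWeakSupersolution {N : ℕ} (j : EuclideanSpace ℝ (Fin N) → ℝ≥0∞)
    (Ω : Set (EuclideanSpace ℝ (Fin N))) (c u : EuclideanSpace ℝ (Fin N) → ℝ) : Prop :=
  ∀ φ : EuclideanSpace ℝ (Fin N) → ℝ, IsNonnegTestFunction Ω φ →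
    ∫ x in Ω, c x * u x * φ x ≤ regionalForm j Ω u φ

/-- `u` is strictly positive in `Ω`: `ess inf_K u > 0` for every compact `K ⊆ Ω`. The essential
infimum is taken in `[-∞,∞]`, so that it is `+∞` when `K` is a null set. -/
def StrictlyPositive {N : ℕ} (Ω : Set (EuclideanSpace ℝ (Fin N)))
    (u : EuclideanSpace ℝ (Fin N) → ℝ) : Prop :=
  ∀ K : Set (EuclideanSpace ℝ (Fin N)), IsCompact K → K ⊆ Ω →
    0 < essInf (fun x => (u x : EReal)) (volume.restrict K)

end RegionalSMP

/-! Positivity propagates through the jumps of the kernel. Suppose `u ≥ δ` on a set `M` disjoint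
from a closed ball, and the kernel carries a uniform amount of mass from each point of the ball into
`M`. Testing with `(aψ - u)⁺`, for a bump `ψ` on the ball, gives a gain of order `δ ∫ φ` from the
jumps into `M` and losses of order `a ∫ φ` from `ψ` and the zeroth order term. For small `a` this
forces `φ = 0` a.e., hence `u ≥ a` on the half ball (`exists_ae_ge_ball`). The test function is not
smooth, so the inequality is first extended to test functions of finite energy
(`exists_super_of_finite_energy`).

Near the origin the kernel is bounded below on a set `A` of positive measure, and by evenness also
on `-A`. The barrier thus moves positivity from `y` to `y + z` for `±z ∈ A`, as long as the target
stays in `Ω`. By Steinhaus, `A - A` is a neighbourhood of `0`, so two jumps reach every point close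
to `y`. Hence each point of `Ω` either has `u` bounded below near it or has `u = 0` a.e. near it
(`subset_union`). These alternatives define disjoint open sets, and connectedness leaves only one of
them. -/

namespace RegionalSMP

/-! ### Translations in `L²` pairings -/

section TranslationPairing

variable {H X : Type*} [TopologicalSpace X] [R1Space X] [MeasurableSpace X] [BorelSpace X]
  {ν : Measure X} [IsLocallyFiniteMeasure ν] [ν.InnerRegularCompactLTTop]

/-- The `L²` pairing of `V` with the translates of `W` depends continuously on the translation. -/
theorem continuous_integral_mul_comp [TopologicalSpace H] {V W : X → ℝ} (hV : MemLp V 2 ν)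
    (hW : MemLp W 2 ν) {T : H → X → X} (hT : Continuous (Function.uncurry T))
    (hTp : ∀ h, MeasurePreserving (T h) ν ν) :
    Continuous fun h => ∫ p, V p * W (T h p) ∂ν := by
  let g : C(H, C(X, X)) := (ContinuousMap.mk (Function.uncurry T) hT).curry
  have hg : ∀ h, MeasurePreserving (g h) ν ν := hTp
  have key : Continuous fun h => Lp.compMeasurePreserving (g h) (hg h) (hW.toLp W) :=
    Continuous.compMeasurePreservingLp (f := fun _ => hW.toLp W) (g := g) continuous_const g.continuous hg
      (p := 2) (by simp)
  have := (continuous_const (y := hV.toLp V)).inner (𝕜 := ℝ) key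
  refine this.congr fun h => ?_
  rw [L2.inner_def]
  refine integral_congr_ae ?_
  have h1 := hV.coeFn_toLp
  have h2 := Lp.coeFn_compMeasurePreserving (hW.toLp W) (hg h)
  have h3 := (hTp h).quasiMeasurePreserving.ae_eq_comp hW.coeFn_toLp
  filter_upwards [h1, h2, h3] with p h1 h2 h3
  have h4 : (hW.toLp W : X → ℝ) (T h p) = W (T h p) := h3
  rw [h1, h2]
  change inner ℝ (V p) ((hW.toLp W : X → ℝ) (T h p)) = _
  rw [h4]
  simp [mul_comm]

variable [TopologicalSpace H] [MeasurableSpace H] [BorelSpace H]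
  [SecondCountableTopology X] {μ : Measure H} [SFinite μ] [IsFiniteMeasureOnCompacts μ] [SFinite ν]

/-- Averaging the translates of `W` commutes with the `L²` pairing with `V`. -/
theorem integral_mul_integral_comp {V W : X → ℝ} (hV : MemLp V 2 ν) (hVm : Measurable V)
    (hW : MemLp W 2 ν) (hWm : Measurable W) {T : H → X → X}
    (hT : Continuous (Function.uncurry T))
    (hTp : ∀ h, MeasurePreserving (T h) ν ν) {ρ : H → ℝ} (hρ : Continuous ρ)
    (hρc : HasCompactSupport ρ) :
    ∫ p, V p * ∫ h, ρ h * W (T h p) ∂μ ∂ν = ∫ h, ρ h * ∫ p, V p * W (T h p) ∂ν ∂μ := by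
  -- Fubini applies because the `p`-integral of the absolute value is again a pairing with
  -- translates, hence continuous in `h`, and `ρ` has compact support.
  have hint : Integrable (Function.uncurry fun h p => ρ h * (V p * W (T h p))) (μ.prod ν) := by
    rw [integrable_prod_iff]
    · refine ⟨.of_forall fun h => ?_, ?_⟩
      · exact (hV.integrable_mul (hW.comp_measurePreserving (hTp h))).const_mul (ρ h)
      · have hc := continuous_integral_mul_comp hV.norm hW.norm hT hTp
        have : Integrable (fun h => ‖ρ h‖ * ∫ p, ‖V p‖ * ‖W (T h p)‖ ∂ν) μ :=
          (hρ.norm.mul hc).integrable_of_hasCompactSupport hρc.norm.mul_right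
        refine this.congr (.of_forall fun h => ?_)
        simp only [Function.uncurry, norm_mul]
        rw [integral_const_mul]
    · refine Measurable.aestronglyMeasurable ?_
      exact (hρ.measurable.comp measurable_fst).mul
        ((hVm.comp measurable_snd).mul (hWm.comp hT.measurable))
  have h1 : ∀ p, V p * ∫ h, ρ h * W (T h p) ∂μ = ∫ h, ρ h * (V p * W (T h p)) ∂μ := fun p => by
    rw [← integral_const_mul]
    congr 1; ext h; ring
  simp_rw [h1]
  rw [← integral_integral_swap hint]
  simp_rw [integral_const_mul]

end TranslationPairing

end RegionalSMP

/-! ### Energy estimates for smooth functions -/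

namespace RegionalSMP

/-- The Euclidean space `ℝ^N`. -/
abbrev Euc (N : ℕ) := EuclideanSpace ℝ (Fin N)

/-- A real-valued everywhere measurable version of a Lévy kernel. -/
structure RealLevyKernel {N : ℕ} (k : Euc N → ℝ) : Prop where
  measurable : Measurable k
  nonneg : ∀ z, 0 ≤ k z
  even : ∀ z, k (-z) = k z
  integrable : Integrable (fun z => min 1 (‖z‖ ^ 2) * k z)

/-- The weighted difference `(f(x) - f(y)) √k(x - y)`, whose `L²` inner products are the
nonlocal energies. -/
noncomputable def wdiff {N : ℕ} (k f : Euc N → ℝ) (p : Euc N × Euc N) : ℝ :=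
  (f p.1 - f p.2) * √(k (p.1 - p.2))

theorem measurable_wdiff {N : ℕ} {k f : Euc N → ℝ} (hk : Measurable k) (hf : Measurable f) :
    Measurable (wdiff k f) := by
  unfold wdiff; fun_prop

theorem wdiff_mul_wdiff {N : ℕ} {k : Euc N → ℝ} (hk : ∀ z, 0 ≤ k z) (f g : Euc N → ℝ)
    (p : Euc N × Euc N) :
    wdiff k f p * wdiff k g p = (f p.1 - f p.2) * (g p.1 - g p.2) * k (p.1 - p.2) := by
  unfold wdiff
  rw [show (f p.1 - f p.2) * √(k (p.1 - p.2)) * ((g p.1 - g p.2) * √(k (p.1 - p.2)))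
    = (f p.1 - f p.2) * (g p.1 - g p.2) * (√(k (p.1 - p.2)) * √(k (p.1 - p.2))) by ring,
    Real.mul_self_sqrt (hk _)]

/-- Control of first and second differences at the scale `min 1 |z|²`. -/
structure DiffBound {N : ℕ} (ψ : Euc N → ℝ) (C : ℝ) : Prop where
  nonneg : 0 ≤ C
  first : ∀ x z, (ψ x - ψ (x - z)) ^ 2 ≤ C * min 1 (‖z‖ ^ 2)
  second : ∀ x z, 2 * ψ x - ψ (x - z) - ψ (x + z) ≤ C * min 1 (‖z‖ ^ 2)

/-- Large `z` are handled by the sup norm `B`; small `z` by the Lipschitz constants `L` of `ψ` and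
`L'` of its derivative. In the second difference the gradient terms at `z` and `-z` cancel. -/
theorem exists_diffBound {N : ℕ} {ψ : Euc N → ℝ} (hψ : ContDiff ℝ ∞ ψ)
    (hψc : HasCompactSupport ψ) : ∃ C, DiffBound ψ C := by
  obtain ⟨B, hB⟩ := hψc.exists_bound_of_continuous hψ.continuous
  obtain ⟨L, hL⟩ := ContDiff.lipschitzWith_of_hasCompactSupport hψc hψ (by simp)
  obtain ⟨L', hL'⟩ := ContDiff.lipschitzWith_of_hasCompactSupport (n := 1) (hψc.fderiv ℝ)
    (hψ.fderiv_right (m := 1) (by norm_cast)) (by simp)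
  have hB0 : 0 ≤ B := (norm_nonneg _).trans (hB 0)
  have taylor : ∀ x z, |ψ (x + z) - ψ x - fderiv ℝ ψ x z| ≤ L' * ‖z‖ ^ 2 := by
    intro x z
    have h := (convex_closedBall x ‖z‖).norm_image_sub_le_of_norm_fderiv_le' (𝕜 := ℝ) (f := ψ)
      (C := L' * ‖z‖) (φ := fderiv ℝ ψ x) (x := x) (y := x + z)
      (fun y _ => hψ.differentiable (by simp) y)
      (fun y hy => by
        refine (hL'.norm_sub_le y x).trans ?_
        gcongr
        simpa [dist_eq_norm] using hy) (by simp) (by simp)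
    simpa [pow_two, mul_assoc] using h
  refine ⟨4 * B ^ 2 + L ^ 2 + 4 * B + 2 * L', by positivity, fun x z => ?_, fun x z => ?_⟩
  · have h1 : |ψ x - ψ (x - z)| ≤ 2 * B := by
      have := (norm_sub_le (ψ x) (ψ (x - z))).trans (add_le_add (hB _) (hB _))
      rw [Real.norm_eq_abs] at this; linarith
    have h2 : |ψ x - ψ (x - z)| ≤ L * ‖z‖ := by
      have := hL.norm_sub_le x (x - z)
      simpa using this
    have h1' : (ψ x - ψ (x - z)) ^ 2 ≤ 4 * B ^ 2 := by
      rw [← sq_abs]; nlinarith [abs_nonneg (ψ x - ψ (x - z))]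
    have h2' : (ψ x - ψ (x - z)) ^ 2 ≤ L ^ 2 * ‖z‖ ^ 2 := by
      rw [← sq_abs, ← mul_pow]; gcongr
    have hL0 : (0 : ℝ) ≤ L' := L'.2
    rcases min_cases (1 : ℝ) (‖z‖ ^ 2) with ⟨h, _⟩ | ⟨h, _⟩ <;> rw [h]
    · nlinarith [sq_nonneg (L : ℝ)]
    · nlinarith [mul_nonneg (sq_nonneg B) (sq_nonneg ‖z‖), mul_nonneg hB0 (sq_nonneg ‖z‖),
        mul_nonneg hL0 (sq_nonneg ‖z‖)]
  · have hL0 : (0 : ℝ) ≤ L' := L'.2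
    have t1 := taylor x z
    have t2 := taylor x (-z)
    rw [← sub_eq_add_neg, map_neg, norm_neg] at t2
    have b1 := abs_le.1 (hB x)
    have b2 := abs_le.1 (hB (x - z))
    have b3 := abs_le.1 (hB (x + z))
    rw [abs_le] at t1 t2
    rcases min_cases (1 : ℝ) (‖z‖ ^ 2) with ⟨h, _⟩ | ⟨h, _⟩ <;> rw [h]
    · nlinarith [sq_nonneg (L : ℝ), sq_nonneg B]
    · nlinarith [mul_nonneg (sq_nonneg B) (sq_nonneg ‖z‖), mul_nonneg hB0 (sq_nonneg ‖z‖),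
        mul_nonneg hL0 (sq_nonneg ‖z‖), mul_nonneg (sq_nonneg (L : ℝ)) (sq_nonneg ‖z‖)]

variable {N : ℕ} {k ψ : Euc N → ℝ} {C : ℝ}

/-- The squared weighted difference vanishes unless one of the points lies in `K`, so it is
dominated by `C (1 ∧ |x-y|²) k(x-y) (1_K(x) + 1_K(y))`. -/
theorem memLp_wdiff_of_diffBound (hk : RealLevyKernel k) (hψc : Continuous ψ) (hψ : DiffBound ψ C)
    {K : Set (Euc N)} (hK : IsCompact K) (hψK : ∀ x ∉ K, ψ x = 0) :
    MemLp (wdiff k ψ) 2 := by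
  have hm : Measurable (wdiff k ψ) := measurable_wdiff hk.measurable hψc.measurable
  rw [memLp_two_iff_integrable_sq hm.aestronglyMeasurable]
  have hi : Integrable (K.indicator (fun _ => (1 : ℝ))) :=
    (integrable_indicator_iff hK.measurableSet).2 (integrableOn_const hK.measure_ne_top)
  have h1 : Integrable (fun p : Euc N × Euc N =>
      (min 1 (‖p.1 - p.2‖ ^ 2) * k (p.1 - p.2)) * K.indicator (fun _ => (1 : ℝ)) p.2) :=
    (measurePreserving_sub_prod volume volume).integrable_comp_of_integrable
      (hk.integrable.mul_prod hi)
  have h2 := ((h1.swap).add h1).const_mul C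
  refine h2.mono' (hm.pow_const 2).aestronglyMeasurable (.of_forall fun p => ?_)
  have hsymm : k (p.2 - p.1) = k (p.1 - p.2) := by rw [← hk.even, neg_sub]
  have hnorm : ‖p.2 - p.1‖ = ‖p.1 - p.2‖ := norm_sub_rev _ _
  rw [Real.norm_of_nonneg (sq_nonneg _), pow_two, wdiff_mul_wdiff hk.nonneg, ← pow_two]
  simp only [Pi.add_apply, Function.comp, Prod.fst_swap, Prod.snd_swap, hsymm, hnorm]
  have hf := hψ.first p.1 (p.1 - p.2)
  rw [sub_sub_cancel] at hf
  have hk0 := hk.nonneg (p.1 - p.2)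
  have hb : 0 ≤ min 1 (‖p.1 - p.2‖ ^ 2) * k (p.1 - p.2) := by positivity
  by_cases hx : p.1 ∈ K
  · have : 0 ≤ K.indicator (fun _ => (1 : ℝ)) p.2 := indicator_nonneg (by simp) _
    rw [indicator_of_mem hx]
    nlinarith [mul_le_mul_of_nonneg_right hf hk0, mul_nonneg hψ.nonneg (mul_nonneg hb this)]
  · by_cases hy : p.2 ∈ K
    · rw [indicator_of_mem hy, indicator_of_notMem hx]
      nlinarith [mul_le_mul_of_nonneg_right hf hk0]
    · rw [hψK _ hx, hψK _ hy, indicator_of_notMem hx, indicator_of_notMem hy]; simp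

/-- A weak form of the boundedness of the operator applied to `ψ`. For fixed `z`, translating `y`
moves the difference from `φ` onto `ψ`, producing a second difference. The bound therefore involves
only `∫ φ`, not the energy of `φ`; since `φ ≥ 0`, a one-sided bound on the second difference
suffices. -/
theorem integral_wdiff_mul_wdiff_le (hk : RealLevyKernel k) (hψc : Continuous ψ)
    (hψ : DiffBound ψ C) {K : Set (Euc N)} (hK : IsCompact K) (hψK : ∀ x ∉ K, ψ x = 0)
    {φ : Euc N → ℝ} (hφm : Measurable φ) (hφ0 : ∀ x, 0 ≤ φ x) (hφi : Integrable φ)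
    (hφ2 : MemLp (wdiff k φ) 2) :
    ∫ p, wdiff k ψ p * wdiff k φ p ≤ C * (∫ z, min 1 (‖z‖ ^ 2) * k z) * ∫ x, φ x := by
  have hint : Integrable (fun p => wdiff k ψ p * wdiff k φ p) :=
    (memLp_wdiff_of_diffBound hk hψc hψ hK hψK).integrable_mul hφ2
  have hmp := measurePreserving_add_prod (volume : Measure (Euc N)) (volume : Measure (Euc N))
  have hmeas : Measurable fun p => wdiff k ψ p * wdiff k φ p :=
    (measurable_wdiff hk.measurable hψc.measurable).mul (measurable_wdiff hk.measurable hφm)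
  have hB : ∃ B, ∀ x, ‖ψ x‖ ≤ B :=
    (HasCompactSupport.intro hK fun x hx => hψK x hx).exists_bound_of_continuous hψc
  obtain ⟨B, hB⟩ := hB
  have hint' := hmp.integrable_comp_of_integrable hint
  have hval : ∫ p, wdiff k ψ p * wdiff k φ p =
      ∫ z : Euc N, ∫ y : Euc N, (ψ (z + y) - ψ y) * (φ (z + y) - φ y) * k z := by
    rw [Measure.volume_eq_prod]
    conv_lhs => rw [← hmp.map_eq]
    rw [integral_map hmp.measurable.aemeasurable hmeas.aestronglyMeasurable]
    refine (integral_prod _ hint').trans ?_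
    simp only [Function.comp, wdiff_mul_wdiff hk.nonneg, add_sub_cancel_right]
  have hint2 : Integrable fun z : Euc N =>
      ∫ y : Euc N, (ψ (z + y) - ψ y) * (φ (z + y) - φ y) * k z := by
    have := hint'.integral_prod_left
    simpa only [Function.comp, wdiff_mul_wdiff hk.nonneg, add_sub_cancel_right] using this
  have hinner : ∀ z : Euc N, ∫ y : Euc N, (ψ (z + y) - ψ y) * (φ (z + y) - φ y) * k z
      ≤ C * (min 1 (‖z‖ ^ 2) * k z) * ∫ x, φ x := by
    intro z
    have hbd : ∀ g : Euc N → Euc N, Continuous g → ∀ h : Euc N → Euc N, Continuous h →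
        ∀ f : Euc N → ℝ, Integrable f → Integrable fun y => (ψ (g y) - ψ (h y)) * f y := by
      intro g hg h hh f hf
      refine hf.bdd_mul (c := B + B) (by fun_prop) (.of_forall fun y => ?_)
      exact (norm_sub_le _ _).trans (add_le_add (hB _) (hB _))
    have hφz : Integrable fun y => φ (z + y) := hφi.comp_add_left z
    have e1 : ∫ y : Euc N, (ψ (z + y) - ψ y) * φ (z + y) = ∫ y, (ψ y - ψ (y - z)) * φ y := by
      rw [← integral_add_left_eq_self (fun y => (ψ y - ψ (y - z)) * φ y) z]
      simp
    have e2 : ∫ y : Euc N, (ψ (z + y) - ψ y) * (φ (z + y) - φ y)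
        = ∫ y, (2 * ψ y - ψ (y - z) - ψ (y + z)) * φ y := by
      calc _ = ∫ y : Euc N, ((ψ (z + y) - ψ y) * φ (z + y) - (ψ (z + y) - ψ y) * φ y) := by
            congr 1; ext y; ring
        _ = (∫ y, (ψ y - ψ (y - z)) * φ y) - ∫ y : Euc N, (ψ (z + y) - ψ y) * φ y := by
            rw [integral_sub (hbd _ (by fun_prop) _ (by fun_prop) _ hφz)
              (hbd _ (by fun_prop) _ (by fun_prop) _ hφi), e1]
        _ = _ := by
            rw [← integral_sub (hbd _ (by fun_prop) _ (by fun_prop) _ hφi)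
              (hbd _ (by fun_prop) _ (by fun_prop) _ hφi)]
            congr 1; ext y; rw [add_comm z y]; ring
    rw [integral_mul_const, e2]
    have e3 : ∫ y, (2 * ψ y - ψ (y - z) - ψ (y + z)) * φ y
        ≤ ∫ y, (C * min 1 (‖z‖ ^ 2)) * φ y := by
      refine integral_mono ?_ (hφi.const_mul _)
        fun y => mul_le_mul_of_nonneg_right (hψ.second y z) (hφ0 y)
      have := (hbd _ continuous_id _ (continuous_id.sub (continuous_const (y := z))) _ hφi).sub
        (hbd _ (continuous_id.add (continuous_const (y := z))) _ continuous_id _ hφi)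
      refine this.congr (.of_forall fun y => ?_)
      simp only [Pi.sub_apply, Pi.add_apply, id]; ring
    rw [integral_const_mul] at e3
    nlinarith [mul_le_mul_of_nonneg_right e3 (hk.nonneg z)]
  rw [hval]
  refine (integral_mono hint2 ((hk.integrable.const_mul C).mul_const _) hinner).trans ?_
  rw [integral_mul_const, integral_const_mul]

end RegionalSMP

/-! ### Supersolutions and test functions of finite energy -/

namespace RegionalSMP

variable {N : ℕ} {k u : Euc N → ℝ} {Ω : Set (Euc N)}

/-- Nonnegative supersolutions, with the zeroth order coefficient replaced on compact sets by a
nonpositive constant, and all data everywhere measurable. -/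
structure RealSupersolution {N : ℕ} (k : Euc N → ℝ) (Ω : Set (Euc N)) (u : Euc N → ℝ) :
    Prop where
  isOpen : IsOpen Ω
  measurable : Measurable u
  nonneg : ∀ x, 0 ≤ u x
  memLp : ∀ K, IsCompact K → K ⊆ Ω → MemLp u 2 (volume.restrict K)
  energy : ∀ K, IsCompact K → K ⊆ Ω → MemLp (wdiff k u) 2 (volume.restrict (K ×ˢ Ω))
  super : ∀ K, IsCompact K → K ⊆ Ω → ∃ C, 0 ≤ C ∧ ∀ φ, IsNonnegTestFunction Ω φ →
    tsupport φ ⊆ K → -C * ∫ x in Ω, u x * φ x ≤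
      ∫ p in Ω ×ˢ Ω, wdiff k u p * wdiff k φ p

/-- The pairs of points of `Ω` with at least one entry in `K`. -/
def crossSet (Ω K : Set (Euc N)) : Set (Euc N × Euc N) := (K ×ˢ Ω) ∪ (Ω ×ˢ K)

theorem wdiff_swap (hk : RealLevyKernel k) (f : Euc N → ℝ) (p : Euc N × Euc N) :
    wdiff k f p.swap = -wdiff k f p := by
  unfold wdiff
  rw [Prod.fst_swap, Prod.snd_swap, ← hk.even, neg_sub]; ring

theorem RealSupersolution.memLp_cross (hk : RealLevyKernel k) (hu : RealSupersolution k Ω u)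
    {K : Set (Euc N)} (hK : IsCompact K) (hKΩ : K ⊆ Ω) :
    MemLp ((crossSet Ω K).indicator (wdiff k u)) 2 := by
  have hm := measurable_wdiff hk.measurable hu.measurable
  have hS1 : MeasurableSet (K ×ˢ Ω) := hK.measurableSet.prod hu.isOpen.measurableSet
  have hS2 : MeasurableSet (Ω ×ˢ K) := hu.isOpen.measurableSet.prod hK.measurableSet
  have h1 : MemLp ((K ×ˢ Ω).indicator (wdiff k u)) 2 :=
    (memLp_indicator_iff_restrict hS1).2 (hu.energy K hK hKΩ)
  have h2 : MemLp ((Ω ×ˢ K).indicator (wdiff k u)) 2 := by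
    have := (h1.comp_measurePreserving
      (Measure.measurePreserving_swap (μ := (volume : Measure (Euc N))) (ν := volume))).neg
    refine (memLp_congr_ae (.of_forall fun p => ?_)).1 this
    simp only [Pi.neg_apply, Function.comp]
    by_cases hp : p ∈ Ω ×ˢ K
    · rw [indicator_of_mem hp, indicator_of_mem (by exact ⟨hp.2, hp.1⟩), wdiff_swap hk, neg_neg]
    · rw [indicator_of_notMem hp, indicator_of_notMem (fun h => hp ⟨h.2, h.1⟩), neg_zero]
  refine (h1.norm.add h2.norm).mono (hm.indicator (hS1.union hS2)).aestronglyMeasurable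
    (.of_forall fun p => ?_)
  refine le_trans ?_ (le_abs_self _)
  by_cases hp : p ∈ crossSet Ω K
  · rw [indicator_of_mem hp, Pi.add_apply]
    rcases hp with hp | hp <;> rw [indicator_of_mem hp] <;> simp
  · rw [indicator_of_notMem hp, norm_zero, Pi.add_apply]; positivity

/-- This trades the form on `Ω ×ˢ Ω` for a pairing on the whole space, where translations act and
where the truncated `wdiff k u` is in `L²`. -/
theorem crossSet_indicator_mul {K : Set (Euc N)} (hKΩ : K ⊆ Ω) {φ : Euc N → ℝ}
    (hφK : ∀ x ∉ K, φ x = 0) (f : Euc N × Euc N → ℝ) (p : Euc N × Euc N) :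
    (crossSet Ω K).indicator f p * wdiff k φ p =
      (Ω ×ˢ Ω).indicator (fun p => f p * wdiff k φ p) p := by
  by_cases hp : p ∈ crossSet Ω K
  · have hp' : p ∈ Ω ×ˢ Ω := by
      rcases hp with hp | hp
      · exact ⟨hKΩ hp.1, hp.2⟩
      · exact ⟨hp.1, hKΩ hp.2⟩
    rw [indicator_of_mem hp, indicator_of_mem hp']
  · rw [indicator_of_notMem hp, zero_mul]
    by_cases hp' : p ∈ Ω ×ˢ Ω
    · rw [indicator_of_mem hp']
      have h1 : φ p.1 = 0 := hφK _ fun h => hp (.inl ⟨h, hp'.2⟩)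
      have h2 : φ p.2 = 0 := hφK _ fun h => hp (.inr ⟨hp'.1, h⟩)
      simp [wdiff, h1, h2]
    · rw [indicator_of_notMem hp']

/-- The supersolution inequality extends from smooth test functions to test functions of finite
energy supported in a compact subset of `Ω`. -/
theorem RealSupersolution.exists_super_of_finite_energy (hk : RealLevyKernel k)
    (hu : RealSupersolution k Ω u) {K : Set (Euc N)} (hK : IsCompact K) (hKΩ : K ⊆ Ω) :
    ∃ C, 0 ≤ C ∧ ∀ φ : Euc N → ℝ, Measurable φ → (∀ x, 0 ≤ φ x) → (∀ x ∉ K, φ x = 0) →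
      Integrable φ → MemLp φ 2 → MemLp (wdiff k φ) 2 →
      -C * ∫ x in Ω, u x * φ x ≤ ∫ p in Ω ×ˢ Ω, wdiff k u p * wdiff k φ p := by
  obtain ⟨r, hr, hrΩ⟩ := hK.exists_cthickening_subset_open hu.isOpen hKΩ
  set K' := Metric.cthickening r K with hK'
  have hK'c : IsCompact K' := hK.cthickening
  obtain ⟨C, hC, hsuper⟩ := hu.super K' hK'c hrΩ
  refine ⟨C, hC, fun φ hφm hφ0 hφK hφi hφ2 hφE => ?_⟩
  have hKK' : K ⊆ K' := Metric.self_subset_cthickening K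
  have hΩm := hu.isOpen.measurableSet
  set U := (crossSet Ω K').indicator (wdiff k u) with hU
  have hSm : MeasurableSet (crossSet Ω K') :=
    (hK'c.measurableSet.prod hΩm).union (hΩm.prod hK'c.measurableSet)
  have hUm : Measurable U := (measurable_wdiff hk.measurable hu.measurable).indicator hSm
  have hU2 : MemLp U 2 := hu.memLp_cross hk hK'c hrΩ
  set V := K'.indicator u with hV
  have hVm : Measurable V := hu.measurable.indicator hK'c.measurableSet
  have hV2 : MemLp V 2 := (memLp_indicator_iff_restrict hK'c.measurableSet).2 (hu.memLp K' hK'c hrΩ)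
  have hΦm := measurable_wdiff hk.measurable hφm
  let T : Euc N → Euc N × Euc N → Euc N × Euc N := fun h p => (p.1 - h, p.2 - h)
  let t : Euc N → Euc N → Euc N := fun h x => x - h
  have hT : Continuous (Function.uncurry T) := by
    simp only [Function.uncurry_def, T]; fun_prop
  have ht : Continuous (Function.uncurry t) := by
    simp only [Function.uncurry_def, t]; fun_prop
  have htp : ∀ h, MeasurePreserving (t h) volume volume := fun h =>
    measurePreserving_sub_right volume h
  have hTp : ∀ h, MeasurePreserving (T h) volume volume := fun h => (htp h).prod (htp h)
  have hV_eq : ∀ f : Euc N → ℝ, (∀ x ∉ K', f x = 0) → ∫ x, V x * f x = ∫ x in Ω, u x * f x := by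
    intro f hf
    rw [← integral_indicator hΩm]
    refine integral_congr_ae (.of_forall fun x => ?_)
    by_cases hx : x ∈ K'
    · simp [hV, hx, hrΩ hx]
    · by_cases hx' : x ∈ Ω <;> simp [hf x hx, hx']
  have hU_eq : ∀ f : Euc N → ℝ, (∀ x ∉ K', f x = 0) → ∫ p, U p * wdiff k f p =
      ∫ p in Ω ×ˢ Ω, wdiff k u p * wdiff k f p := by
    intro f hf
    rw [← integral_indicator (hΩm.prod hΩm)]
    simp only [hU, crossSet_indicator_mul hrΩ hf]
  -- `L h` is the defect of the inequality for `φ` translated by `h`. If it were negative at `0`, it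
  -- would be negative nearby, and so would its average against a bump `ρ`. That average is the
  -- defect of the smooth test function `ρ * φ`, hence nonnegative. No energy convergence of
  -- mollifiers is needed.
  let L : Euc N → ℝ := fun h => (∫ p, U p * wdiff k φ (T h p)) + C * ∫ x, V x * φ (t h x)
  have hL : Continuous L := (continuous_integral_mul_comp hU2 hφE hT hTp).add
    ((continuous_integral_mul_comp hV2 hφ2 ht htp).const_mul C)
  have hφK' : ∀ x ∉ K', φ x = 0 := fun x hx => hφK x fun h => hx (hKK' h)
  have hL0 : L 0 = (∫ p in Ω ×ˢ Ω, wdiff k u p * wdiff k φ p) + C * ∫ x in Ω, u x * φ x := by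
    simp only [L, T, t, sub_zero]
    rw [← hV_eq φ hφK', ← hU_eq φ hφK']
  by_contra! hlt
  have hL0' : L 0 < 0 := by rw [hL0]; linarith
  obtain ⟨s, hs, hsL⟩ := Metric.isOpen_iff.1 (isOpen_lt hL continuous_const) 0 hL0'
  -- Radius `s` keeps `L` negative; radius `r` keeps the support of the mollified function in `K'`.
  have hs' : 0 < min s r := lt_min hs hr
  let ρ : ContDiffBump (0 : Euc N) := ⟨min s r / 2, min s r, by positivity, by linarith⟩
  have hρ_supp : ∀ h, ρ h ≠ 0 → ‖h‖ < min s r := fun h hh => by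
    have : h ∈ Function.support ρ := hh
    rwa [ρ.support_eq, mem_ball_zero_iff] at this
  let φρ : Euc N → ℝ := fun x => ∫ h, ρ h * φ (t h x)
  have hφρ_eq : φρ = convolution ρ φ (ContinuousLinearMap.mul ℝ ℝ) volume := by
    ext x; simp [φρ, convolution, t]
  have hρint : ∀ x, Integrable fun h => ρ h * φ (t h x) := fun x => by
    obtain ⟨B, hB⟩ := ρ.hasCompactSupport.exists_bound_of_continuous ρ.continuous
    exact (hφi.comp_sub_left x).bdd_mul ρ.continuous.aestronglyMeasurable (.of_forall hB)
  have hφρ0 : ∀ x ∉ K', φρ x = 0 := by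
    intro x hx
    refine integral_eq_zero_of_ae (.of_forall fun h => ?_)
    by_cases hh : ρ h = 0
    · simp [hh]
    · have : x - h ∉ K := fun hxK => hx <| by
        refine Metric.mem_cthickening_of_dist_le x (x - h) r K hxK ?_
        have := (hρ_supp h hh).le.trans (min_le_right _ _)
        simpa [dist_eq_norm] using this
      simp [t, hφK _ this]
  have htsupp : tsupport φρ ⊆ K' := by
    refine closure_minimal (fun x hx => ?_) hK'c.isClosed
    by_contra h
    exact hx (hφρ0 x h)
  have htest : IsNonnegTestFunction Ω φρ := by
    refine ⟨?_, HasCompactSupport.intro hK'c hφρ0, htsupp.trans hrΩ, fun x =>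
      integral_nonneg fun h => mul_nonneg ρ.nonneg (hφ0 _)⟩
    rw [hφρ_eq]
    exact ρ.hasCompactSupport.contDiff_convolution_left _ ρ.contDiff hφi.locallyIntegrable
  have h1 := hsuper φρ htest htsupp
  rw [← hV_eq φρ hφρ0, ← hU_eq φρ hφρ0] at h1
  have e1 := integral_mul_integral_comp (μ := volume) hV2 hVm hφ2 hφm ht htp ρ.continuous
    ρ.hasCompactSupport
  have e2 := integral_mul_integral_comp (μ := volume) hU2 hUm hφE hΦm hT hTp ρ.continuous
    ρ.hasCompactSupport
  -- The kernel depends only on `x - y`, so weighted differences commute with averaging over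
  -- simultaneous translations.
  have e3 : ∀ p, wdiff k φρ p = ∫ h, ρ h * wdiff k φ (T h p) := by
    intro p
    simp only [wdiff, φρ, T, sub_sub_sub_cancel_right]
    rw [← integral_sub (hρint _) (hρint _), ← integral_mul_const]
    congr 1; ext h; simp only [t]; ring
  simp only [e3] at h1
  change -C * ∫ x, V x * ∫ h, ρ h * φ (t h x) ≤ _ at h1
  rw [e1, e2] at h1
  have hi1 : Integrable fun h => ρ h * ∫ p, U p * wdiff k φ (T h p) :=
    (ρ.continuous.mul (continuous_integral_mul_comp hU2 hφE hT hTp)).integrable_of_hasCompactSupport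
      ρ.hasCompactSupport.mul_right
  have hi2 : Integrable fun h => ρ h * ∫ x, V x * φ (t h x) :=
    (ρ.continuous.mul (continuous_integral_mul_comp hV2 hφ2 ht htp)).integrable_of_hasCompactSupport
      ρ.hasCompactSupport.mul_right
  have hpos : 0 < ∫ h, ρ h * -L h := by
    refine Continuous.integral_pos_of_hasCompactSupport_nonneg_nonzero (x := 0)
      (ρ.continuous.mul hL.neg) ρ.hasCompactSupport.mul_right (fun h => ?_) ?_
    · by_cases hh : ρ h = 0
      · simp [hh]
      · have : L h < 0 := hsL (by simpa using (hρ_supp h hh).trans_le (min_le_left _ _))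
        exact mul_nonneg ρ.nonneg (by linarith)
    · have : 0 < ρ 0 := ρ.pos_of_mem_ball (by simpa [ρ] using ⟨hs, hr⟩)
      exact mul_ne_zero this.ne' (by linarith)
  have hsum : ∫ h, ρ h * -L h = -((∫ h, ρ h * ∫ p, U p * wdiff k φ (T h p)) +
      C * ∫ h, ρ h * ∫ x, V x * φ (t h x)) := by
    rw [← integral_const_mul, ← integral_add hi1 (hi2.const_mul C), ← integral_neg]
    congr 1; ext h; simp only [L]; ring
  linarith

end RegionalSMP

/-! ### The lower barrier -/

namespace RegionalSMP

variable {N : ℕ} {k u : Euc N → ℝ} {Ω : Set (Euc N)}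

/-- Monotonicity of the positive part, applied to `s - x` and `t - y`. -/
theorem mul_posPart_sub_le {s t x y : ℝ} :
    (x - y) * (max (s - x) 0 - max (t - y) 0) ≤ (s - t) * (max (s - x) 0 - max (t - y) 0) := by
  rcases max_cases (s - x) 0 with ⟨h1, h2⟩ | ⟨h1, h2⟩ <;>
  rcases max_cases (t - y) 0 with ⟨h3, h4⟩ | ⟨h3, h4⟩ <;> rw [h1, h3] <;>
    nlinarith [sq_nonneg (s - x - (t - y))]

/-- Lower barrier: if `u ≥ δ` on a set `M` from which the kernel charges a ball uniformly, then `u`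
is bounded below by a positive constant on the concentric ball of half the radius. -/
theorem RealSupersolution.exists_ae_ge_ball (hk : RealLevyKernel k)
    (hu : RealSupersolution k Ω u) {x₁ : Euc N} {R : ℝ} (hR : 0 < R)
    (hBΩ : Metric.closedBall x₁ R ⊆ Ω) {M A : Set (Euc N)} (hM : MeasurableSet M)
    (hMfin : volume M ≠ ⊤) (hMΩ : M ⊆ Ω) (hMB : Disjoint M (Metric.closedBall x₁ R))
    {δ α κ : ℝ} (hδ : 0 < δ) (hα : 0 < α) (hκ : 0 < κ) (hδM : ∀ x ∈ M, δ ≤ u x)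
    (hA : MeasurableSet A) (hαA : ∀ z ∈ A, α ≤ k z)
    (hκB : ∀ x ∈ Metric.closedBall x₁ R, κ ≤ volume.real (M ∩ {y | x - y ∈ A})) :
    ∃ a, 0 < a ∧ ∀ᵐ x ∂(volume.restrict (Metric.ball x₁ (R / 2))), a ≤ u x := by
  set K := Metric.closedBall x₁ R with hKdef
  have hK : IsCompact K := isCompact_closedBall _ _
  have hΩm := hu.isOpen.measurableSet
  let ψ : ContDiffBump x₁ := ⟨R / 2, R, by positivity, by linarith⟩
  have hψK : ∀ x ∉ K, ψ x = 0 := fun x hx => by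
    refine ψ.zero_of_le_dist ?_
    rw [hKdef, Metric.mem_closedBall, not_le] at hx
    exact hx.le
  have hψi : Integrable ψ := ψ.continuous.integrable_of_hasCompactSupport ψ.hasCompactSupport
  obtain ⟨D, hD⟩ := exists_diffBound ψ.contDiff ψ.hasCompactSupport
  obtain ⟨C, hC, hsuper⟩ := hu.exists_super_of_finite_energy hk hK hBΩ
  have hI0 : 0 ≤ ∫ z, min 1 (‖z‖ ^ 2) * k z := integral_nonneg fun z =>
    mul_nonneg (by positivity) (hk.nonneg z)
  set I := D * ∫ z, min 1 (‖z‖ ^ 2) * k z with hI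
  have hI0' : 0 ≤ I := mul_nonneg hD.nonneg hI0
  -- Chosen so that the losses `a (I + C)` stay strictly below the gain `δ α κ`.
  set a := δ * α * κ / (I + C + 1) with ha
  have ha0 : 0 < a := by positivity
  have haI : a * (I + C) < δ * α * κ := by
    rw [ha, div_mul_eq_mul_div, div_lt_iff₀ (by positivity)]
    nlinarith [show 0 < δ * α * κ by positivity]
  let φ : Euc N → ℝ := fun x => max (a * ψ x - u x) 0
  have hφ0 : ∀ x, 0 ≤ φ x := fun x => le_max_right _ _
  have hφm : Measurable φ :=
    ((ψ.continuous.measurable.const_mul a).sub hu.measurable).max measurable_const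
  have hφψ : ∀ x, φ x ≤ a * ψ x := fun x =>
    max_le (by linarith [hu.nonneg x]) (mul_nonneg ha0.le ψ.nonneg)
  have hφK : ∀ x ∉ K, φ x = 0 := fun x hx => le_antisymm (by simpa [hψK x hx] using hφψ x) (hφ0 x)
  have hφi : Integrable φ := (hψi.const_mul a).mono' hφm.aestronglyMeasurable
    (.of_forall fun x => by rw [Real.norm_of_nonneg (hφ0 x)]; exact hφψ x)
  have hφ2 : MemLp φ 2 := by
    refine ((ψ.continuous.memLp_of_hasCompactSupport ψ.hasCompactSupport).const_mul a).mono
      hφm.aestronglyMeasurable (.of_forall fun x => ?_)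
    rw [Real.norm_of_nonneg (hφ0 x)]
    exact (hφψ x).trans (le_abs_self _)
  have hψE : MemLp (wdiff k ψ) 2 := memLp_wdiff_of_diffBound hk ψ.continuous hD hK hψK
  have hφE : MemLp (wdiff k φ) 2 := by
    refine ((hψE.const_mul a).norm.add (hu.memLp_cross hk hK hBΩ).norm).mono
      (measurable_wdiff hk.measurable hφm).aestronglyMeasurable (.of_forall fun p => ?_)
    refine le_trans ?_ (le_abs_self _)
    rw [Pi.add_apply]
    by_cases hp : p ∈ crossSet Ω K
    · rw [indicator_of_mem hp]
      simp only [wdiff, norm_mul, ← mul_assoc]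
      rw [← add_mul]
      refine mul_le_mul_of_nonneg_right ?_ (norm_nonneg _)
      refine (abs_max_sub_max_le_abs _ _ 0).trans ?_
      rw [← norm_mul]
      simp only [Real.norm_eq_abs]
      refine le_trans (le_of_eq ?_) (abs_sub _ _)
      congr 1; ring
    -- Here the energy of `u` is not controlled, but one of the two points lies outside `K`, where
    -- `φ` and `ψ` vanish, so `0 ≤ φ ≤ a ψ` is enough.
    · rw [indicator_of_notMem hp, norm_zero, add_zero]
      simp only [wdiff, norm_mul, ← mul_assoc]
      refine mul_le_mul_of_nonneg_right ?_ (norm_nonneg _)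
      rw [← norm_mul]
      simp only [Real.norm_eq_abs]
      by_cases hx : p.1 ∈ K
      · have hy : p.2 ∉ K := fun hy => hp (.inl ⟨hx, hBΩ hy⟩)
        rw [hψK _ hy, hφK _ hy, sub_zero, sub_zero, abs_of_nonneg (hφ0 _)]
        exact (hφψ _).trans (le_abs_self _)
      · rw [hψK _ hx, hφK _ hx, zero_sub, zero_sub, abs_neg, mul_neg, abs_neg,
          abs_of_nonneg (hφ0 _)]
        exact (hφψ _).trans (le_abs_self _)
  -- Density of the gain: jumps from a point where `φ` is positive into `M`.
  let G : Euc N × Euc N → ℝ := fun p =>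
    φ p.1 * M.indicator (fun _ => (1 : ℝ)) p.2 * A.indicator (fun _ => (1 : ℝ)) (p.1 - p.2)
  have hMi : Integrable (M.indicator (fun _ => (1 : ℝ))) :=
    (integrable_indicator_iff hM).2 (integrableOn_const hMfin)
  have hG : Integrable G := by
    refine (hφi.mul_prod hMi).mul_bdd (c := 1) ?_ (.of_forall fun p => ?_)
    · exact ((measurable_const.indicator hA).comp (measurable_fst.sub measurable_snd)).aestronglyMeasurable
    · by_cases h : p.1 - p.2 ∈ A <;> simp [h]
  have hGΩ : ∫ p in Ω ×ˢ Ω, G p = ∫ p, G p := by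
    refine setIntegral_eq_integral_of_forall_compl_eq_zero fun p hp => ?_
    by_cases h1 : p.1 ∈ K
    · have : p.2 ∉ M := fun h => hp ⟨hBΩ h1, hMΩ h⟩
      simp [G, this]
    · simp [G, hφK _ h1]
  have hGκ : κ * ∫ x, φ x ≤ ∫ p, G p := by
    have hinner : ∀ x, ∫ y, G (x, y) = φ x * volume.real (M ∩ {y | x - y ∈ A}) := by
      intro x
      have hm : MeasurableSet (M ∩ {y | x - y ∈ A}) := hM.inter
        (hA.preimage (measurable_const.sub measurable_id))
      have : ∀ y, G (x, y) = φ x * (M ∩ {y | x - y ∈ A}).indicator (fun _ => (1 : ℝ)) y := by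
        intro y
        by_cases h1 : y ∈ M <;> by_cases h2 : x - y ∈ A <;> simp [G, h1, h2]
      simp only [this]
      rw [integral_const_mul, integral_indicator hm]
      simp
    rw [Measure.volume_eq_prod, integral_prod _ hG, ← integral_const_mul]
    refine integral_mono (hφi.const_mul κ) hG.integral_prod_left fun x => ?_
    rw [hinner]
    by_cases hx : x ∈ K
    · rw [mul_comm]
      exact mul_le_mul_of_nonneg_left (hκB x hx) (hφ0 x)
    · simp [hφK x hx]
  have hψφ : Integrable fun p => wdiff k ψ p * wdiff k φ p := hψE.integrable_mul hφE
  -- Pairs outside `Ω ×ˢ Ω` have a point outside `K`, so they contribute a nonnegative amount and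
  -- may be added.
  have hψφΩ : ∫ p in Ω ×ˢ Ω, wdiff k ψ p * wdiff k φ p ≤ I * ∫ x, φ x := by
    refine le_trans ?_ (integral_wdiff_mul_wdiff_le hk ψ.continuous hD hK hψK hφm hφ0 hφi hφE)
    rw [← integral_indicator (hΩm.prod hΩm)]
    refine integral_mono (hψφ.indicator (hΩm.prod hΩm)) hψφ fun p => ?_
    by_cases hp : p ∈ Ω ×ˢ Ω
    · rw [indicator_of_mem hp]
    · rw [indicator_of_notMem hp, wdiff_mul_wdiff hk.nonneg]
      by_cases h1 : p.1 ∈ K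
      · have h2 : p.2 ∉ K := fun h => hp ⟨hBΩ h1, hBΩ h⟩
        rw [hψK _ h2, hφK _ h2, sub_zero, sub_zero]
        exact mul_nonneg (mul_nonneg ψ.nonneg (hφ0 _)) (hk.nonneg _)
      · rw [hψK _ h1, hφK _ h1, zero_sub, zero_sub, neg_mul_neg]
        exact mul_nonneg (mul_nonneg ψ.nonneg (hφ0 _)) (hk.nonneg _)
  -- For a jump into `M` the target is outside `K`, so `ψ` and `φ` vanish there and `u ≥ δ` gives
  -- the extra term; elsewhere `mul_posPart_sub_le` suffices.
  have hpt : ∀ p ∈ Ω ×ˢ Ω, wdiff k u p * wdiff k φ p ≤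
      a * (wdiff k ψ p * wdiff k φ p) - δ * α * G p := by
    intro p hp
    rw [wdiff_mul_wdiff hk.nonneg, wdiff_mul_wdiff hk.nonneg]
    have hk0 := hk.nonneg (p.1 - p.2)
    by_cases h : p.2 ∈ M ∧ p.1 - p.2 ∈ A
    · have hy : p.2 ∉ K := fun hy => hMB.le_bot ⟨h.1, hy⟩
      have hGp : G p = φ p.1 := by simp [G, h.1, h.2]
      rw [hGp, hψK _ hy, hφK _ hy, sub_zero, sub_zero]
      have h1 : u p.1 * φ p.1 ≤ a * ψ p.1 * φ p.1 := by
        rcases max_cases (a * ψ p.1 - u p.1) 0 with ⟨e, h2⟩ | ⟨e, h2⟩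
        · exact mul_le_mul_of_nonneg_right (by linarith) (hφ0 _)
        · simp only [φ, e, mul_zero, le_refl]
      have h2 := mul_le_mul_of_nonneg_right (hδM _ h.1) (hφ0 p.1)
      have h3 := mul_le_mul_of_nonneg_left (hαA _ h.2) (mul_nonneg hδ.le (hφ0 p.1))
      have h4 : (u p.1 - u p.2) * φ p.1 ≤ a * ψ p.1 * φ p.1 - δ * φ p.1 := by linarith
      linarith [mul_le_mul_of_nonneg_right h4 hk0]
    · have hGp : G p = 0 := by
        by_cases h1 : p.2 ∈ M
        · have h2 : p.1 - p.2 ∉ A := fun h2 => h ⟨h1, h2⟩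
          simp [G, h2]
        · simp [G, h1]
      rw [hGp, mul_zero, sub_zero, ← mul_assoc, ← mul_assoc]
      refine mul_le_mul_of_nonneg_right ?_ hk0
      have := mul_posPart_sub_le (s := a * ψ p.1) (t := a * ψ p.2) (x := u p.1) (y := u p.2)
      rwa [← mul_sub] at this
  have hUφ : IntegrableOn (fun p => wdiff k u p * wdiff k φ p) (Ω ×ˢ Ω) := by
    have := (hu.memLp_cross hk hK hBΩ).integrable_mul hφE
    refine (integrable_indicator_iff (hΩm.prod hΩm)).1 (this.congr (.of_forall fun p => ?_))
    exact crossSet_indicator_mul hBΩ hφK (wdiff k u) p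
  have h1 := hsuper φ hφm hφ0 hφK hφi hφ2 hφE
  have h2 := setIntegral_mono_on hUφ (((hψφ.const_mul a).sub (hG.const_mul (δ * α))).integrableOn)
    (hΩm.prod hΩm) hpt
  rw [show ∫ p in Ω ×ˢ Ω, ((fun p => a * (wdiff k ψ p * wdiff k φ p)) - fun p => δ * α * G p) p =
    a * (∫ p in Ω ×ˢ Ω, wdiff k ψ p * wdiff k φ p) - δ * α * ∫ p in Ω ×ˢ Ω, G p from by
      rw [← integral_const_mul, ← integral_const_mul, ← integral_sub
        (hψφ.const_mul a).integrableOn (hG.const_mul (δ * α)).integrableOn]; rfl, hGΩ] at h2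
  have h3 : ∫ x in Ω, u x * φ x ≤ a * ∫ x, φ x := by
    have hle : ∀ x, u x * φ x ≤ a * φ x := fun x => by
      rcases max_cases (a * ψ x - u x) 0 with ⟨e, h2⟩ | ⟨e, h2⟩
      · refine mul_le_mul_of_nonneg_right ?_ (hφ0 _)
        have := mul_le_mul_of_nonneg_left (ψ.le_one (x := x)) ha0.le
        linarith
      · simp only [φ, e, mul_zero, le_refl]
    have hi : Integrable fun x => u x * φ x := by
      refine (hφi.const_mul a).mono' (hu.measurable.mul hφm).aestronglyMeasurable
        (.of_forall fun x => ?_)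
      rw [Real.norm_of_nonneg (mul_nonneg (hu.nonneg x) (hφ0 x))]
      exact hle x
    rw [← integral_const_mul]
    refine (setIntegral_le_integral hi (.of_forall fun x => mul_nonneg (hu.nonneg x) (hφ0 x))).trans
      (integral_mono hi (hφi.const_mul a) hle)
  have hφint0 : 0 ≤ ∫ x, φ x := integral_nonneg hφ0
  have h4 : (δ * α * κ - a * (I + C)) * ∫ x, φ x ≤ 0 := by
    have h5 := mul_le_mul_of_nonneg_left hψφΩ ha0.le
    have h6 := mul_le_mul_of_nonneg_left hGκ (mul_nonneg hδ.le hα.le)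
    have h7 := mul_le_mul_of_nonneg_left h3 hC
    nlinarith
  have h5 : ∫ x, φ x = 0 := le_antisymm
    (nonpos_of_mul_nonpos_right h4 (by linarith)) hφint0
  have h6 := (integral_eq_zero_iff_of_nonneg hφ0 hφi).1 h5
  refine ⟨a, ha0, ?_⟩
  rw [ae_restrict_iff' measurableSet_ball]
  filter_upwards [h6] with x hx hxB
  have hψ1 : ψ x = 1 := ψ.one_of_mem_closedBall (Metric.ball_subset_closedBall hxB)
  have : max (a * ψ x - u x) 0 = 0 := hx
  rw [hψ1] at this
  linarith [max_eq_right_iff.1 this]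

end RegionalSMP

/-! ### Propagation of positivity by jumps -/

namespace RegionalSMP

open scoped Topology Pointwise

variable {N : ℕ} {k u : Euc N → ℝ} {Ω : Set (Euc N)}

/-- The points of `Ω` near which `u` is essentially bounded below by a positive constant. -/
def posPoints (Ω : Set (Euc N)) (u : Euc N → ℝ) : Set (Euc N) :=
  {x | x ∈ Ω ∧ ∃ r, 0 < r ∧ ∃ a, 0 < a ∧ ∀ᵐ y ∂(volume.restrict (Metric.ball x r)), a ≤ u y}

/-- The points of `Ω` near which `u` vanishes almost everywhere. -/
def nullPoints (Ω : Set (Euc N)) (u : Euc N → ℝ) : Set (Euc N) :=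
  {x | x ∈ Ω ∧ ∃ r, 0 < r ∧ volume ({y | u y ≠ 0} ∩ Metric.ball x r) = 0}

theorem isOpen_posPoints (hΩ : IsOpen Ω) : IsOpen (posPoints Ω u) := by
  rw [Metric.isOpen_iff]
  rintro x ⟨hx, r, hr, a, ha, h⟩
  obtain ⟨s, hs, hsΩ⟩ := Metric.isOpen_iff.1 hΩ x hx
  refine ⟨min s (r / 2), by positivity, fun y hy => ⟨hsΩ ?_, r / 2, by positivity, a, ha, ?_⟩⟩
  · exact Metric.ball_subset_ball (min_le_left _ _) hy
  · refine ae_restrict_of_ae_restrict_of_subset (fun w hw => ?_) h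
    rw [Metric.mem_ball] at *
    have := dist_triangle w y x
    linarith [min_le_right s (r / 2)]

theorem isOpen_nullPoints (hΩ : IsOpen Ω) : IsOpen (nullPoints Ω u) := by
  rw [Metric.isOpen_iff]
  rintro x ⟨hx, r, hr, h⟩
  obtain ⟨s, hs, hsΩ⟩ := Metric.isOpen_iff.1 hΩ x hx
  refine ⟨min s (r / 2), by positivity, fun y hy => ⟨hsΩ ?_, r / 2, by positivity, ?_⟩⟩
  · exact Metric.ball_subset_ball (min_le_left _ _) hy
  · refine measure_mono_null (inter_subset_inter_right _ fun w hw => ?_) h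
    rw [Metric.mem_ball] at *
    have := dist_triangle w y x
    linarith [min_le_right s (r / 2)]

theorem disjoint_posPoints_nullPoints : Disjoint (posPoints Ω u) (nullPoints Ω u) := by
  rw [Set.disjoint_left]
  rintro x ⟨-, r, hr, a, ha, h⟩ ⟨-, s, hs, h'⟩
  rw [ae_restrict_iff' measurableSet_ball, ae_iff] at h
  have hpos := Metric.measure_ball_pos (volume : Measure (Euc N)) x (lt_min hr hs)
  refine hpos.ne' (measure_mono_null (fun y hy => ?_) (measure_union_null h h'))
  have h1 := Metric.ball_subset_ball (min_le_left r s) hy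
  have h2 := Metric.ball_subset_ball (min_le_right r s) hy
  by_cases hu : a ≤ u y
  · exact .inr ⟨(ha.trans_le hu).ne', h2⟩
  · exact .inl fun h => hu (h h1)

/-- A set of jumps charged by the kernel, all of whose points have full support. -/
structure JumpSet (k : Euc N → ℝ) (A : Set (Euc N)) (α ε : ℝ) : Prop where
  measurableSet : MeasurableSet A
  measure_ne_top : volume A ≠ ⊤
  measure_pos : 0 < volume A
  pos : 0 < α
  le_kernel : ∀ z ∈ A, α ≤ k z
  eps_pos : 0 < ε
  le_norm : ∀ z ∈ A, ε ≤ ‖z‖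
  support : ∀ z ∈ A, ∀ s, 0 < s → 0 < volume (A ∩ Metric.ball z s)

theorem JumpSet.neg (hk : RealLevyKernel k) {A : Set (Euc N)} {α ε : ℝ} (h : JumpSet k A α ε) :
    JumpSet k (-A) α ε where
  measurableSet := h.measurableSet.neg
  measure_ne_top := by rw [Measure.measure_neg]; exact h.measure_ne_top
  measure_pos := by rw [Measure.measure_neg]; exact h.measure_pos
  pos := h.pos
  le_kernel z hz := by rw [← hk.even]; exact h.le_kernel _ hz
  eps_pos := h.eps_pos
  le_norm z hz := by rw [← norm_neg]; exact h.le_norm _ hz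
  support z hz s hs := by
    rw [← Measure.measure_neg, Set.inter_neg, neg_neg, neg_ball]
    exact h.support _ hz s hs

/-- Bounding `k` and `‖z‖` below by `1/(n+1)` exhausts `{k > 0}` up to the origin, so some piece has
positive measure. Intersecting it with the support of its restricted measure loses only a null set.
-/
theorem exists_jumpSet [Nontrivial (Euc N)] (hk : Measurable k) {r : ℝ}
    (hr : volume ({z | 0 < k z} ∩ Metric.ball 0 r) ≠ 0) :
    ∃ A α ε, A ⊆ Metric.ball 0 r ∧ JumpSet k A α ε := by
  let B : ℕ → Set (Euc N) := fun n =>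
    {z | 1 / ((n : ℝ) + 1) ≤ k z} ∩ {z | 1 / ((n : ℝ) + 1) ≤ ‖z‖} ∩ Metric.ball 0 r
  have hBm : ∀ n, MeasurableSet (B n) := fun n =>
    ((measurableSet_le measurable_const hk).inter
      (measurableSet_le measurable_const measurable_norm)).inter measurableSet_ball
  have hex : ∃ n, volume (B n) ≠ 0 := by
    by_contra! h
    refine hr (measure_mono_null (t := {0} ∪ ⋃ n, B n) ?_
      (measure_union_null (measure_singleton 0) (measure_iUnion_null h)))
    rintro z ⟨hz, hzr⟩
    by_cases hz0 : z = 0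
    · exact .inl hz0
    · obtain ⟨n, hn⟩ := exists_nat_one_div_lt (lt_min (show 0 < k z from hz) (norm_pos_iff.2 hz0))
      exact .inr (mem_iUnion.2 ⟨n, ⟨(hn.trans_le (min_le_left _ _)).le,
        (hn.trans_le (min_le_right _ _)).le⟩, hzr⟩)
  obtain ⟨n, hn⟩ := hex
  set S := (volume.restrict (B n)).support with hS
  have hSm : MeasurableSet S := Measure.isClosed_support.measurableSet
  have hnull : volume (B n \ S) = 0 := by
    have : volume.restrict (B n) Sᶜ = 0 := Measure.measure_compl_support
    rwa [Measure.restrict_apply hSm.compl, inter_comm] at this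
  have hle : ∀ T : Set (Euc N), volume (B n ∩ T) ≤ volume (B n ∩ S ∩ T) := by
    intro T
    calc volume (B n ∩ T) ≤ volume ((B n ∩ S ∩ T) ∪ (B n \ S)) := measure_mono fun z hz => by
          by_cases h : z ∈ S
          · exact .inl ⟨⟨hz.1, h⟩, hz.2⟩
          · exact .inr ⟨hz.1, h⟩
      _ ≤ _ := (measure_union_le _ _).trans (by rw [hnull, add_zero])
  have hBr : B n ⊆ Metric.ball 0 r := fun z hz => hz.2
  refine ⟨B n ∩ S, 1 / ((n : ℝ) + 1), 1 / ((n : ℝ) + 1), fun z hz => hBr hz.1,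
    (hBm n).inter hSm, ?_, ?_, by positivity, fun z hz => hz.1.1.1, by positivity,
    fun z hz => hz.1.1.2, fun z hz s hs => ?_⟩
  · exact ((measure_mono (inter_subset_left.trans hBr)).trans_lt measure_ball_lt_top).ne
  · have := hle univ
    rw [inter_univ, inter_univ] at this
    exact (pos_iff_ne_zero.2 hn).trans_le this
  · refine lt_of_lt_of_le ?_ (hle _)
    have := (Measure.mem_support_iff_forall z).1 hz.2 _ (Metric.ball_mem_nhds z hs)
    rwa [Measure.restrict_apply measurableSet_ball, inter_comm] at this

/-- Positivity on `M` spreads to each point from which the jump set reaches `M` with positive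
probability. -/
theorem RealSupersolution.mem_posPoints_of_jump (hk : RealLevyKernel k)
    (hu : RealSupersolution k Ω u) {A : Set (Euc N)} {α ε : ℝ} (hA : JumpSet k A α ε)
    {M : Set (Euc N)} (hM : MeasurableSet M) (hMfin : volume M ≠ ⊤) (hMΩ : M ⊆ Ω) {δ : ℝ}
    (hδ : 0 < δ) (hδM : ∀ x ∈ M, δ ≤ u x) {x₁ : Euc N} (hx₁ : x₁ ∈ Ω) (hx₁M : x₁ ∉ closure M)
    (hpos : volume (M ∩ {y | x₁ - y ∈ A}) ≠ 0) : x₁ ∈ posPoints Ω u := by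
  -- The convolution of two indicators of finite measure is continuous, so positivity at `x₁` gives
  -- the uniform lower bound `F x₁ / 2` on a small ball.
  let F : Euc N → ℝ := fun x => volume.real (M ∩ {y | x - y ∈ A})
  have hF : Continuous F := by
    have h := continuous_integral_mul_comp (H := Euc N) (ν := volume) (T := fun h y => h - y)
      (memLp_indicator_const 2 hM (1 : ℝ) (.inr hMfin))
      (memLp_indicator_const 2 hA.measurableSet (1 : ℝ) (.inr hA.measure_ne_top))
      (by simp only [Function.uncurry_def]; fun_prop)
      (fun h => Measure.measurePreserving_sub_left volume h)
    refine h.congr fun x => ?_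
    have hm : MeasurableSet (M ∩ {y | x - y ∈ A}) := hM.inter
      (hA.measurableSet.preimage (measurable_const.sub measurable_id))
    have : ∀ y, M.indicator (fun _ => (1 : ℝ)) y * A.indicator (fun _ => (1 : ℝ)) (x - y) =
        (M ∩ {y | x - y ∈ A}).indicator (fun _ => (1 : ℝ)) y := by
      intro y
      by_cases h1 : y ∈ M <;> by_cases h2 : x - y ∈ A <;> simp [h1, h2]
    simp only [this]
    rw [integral_indicator hm]
    simp [F]
  have hF0 : 0 < F x₁ := ENNReal.toReal_pos hpos
    ((measure_mono inter_subset_left).trans_lt hMfin.lt_top).ne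
  have hnhds : Ω ∩ (closure M)ᶜ ∩ {x | F x₁ / 2 < F x} ∈ 𝓝 x₁ := by
    refine Filter.inter_mem (Filter.inter_mem (hu.isOpen.mem_nhds hx₁)
      (isClosed_closure.isOpen_compl.mem_nhds hx₁M)) ?_
    exact (isOpen_lt continuous_const hF).mem_nhds (by simp only [mem_ofPred_eq]; linarith)
  obtain ⟨R, hR, hRs⟩ := Metric.nhds_basis_closedBall.mem_iff.1 hnhds
  obtain ⟨a, ha, h⟩ := hu.exists_ae_ge_ball hk hR (fun x hx => (hRs hx).1.1) hM hMfin hMΩ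
    (Set.disjoint_left.2 fun x hx hx' => (hRs hx').1.2 (subset_closure hx)) hδ hA.pos
    (half_pos hF0) hδM hA.measurableSet hA.le_kernel (fun x hx => (hRs hx).2.le)
  exact ⟨hx₁, R / 2, by positivity, a, ha, h⟩

theorem RealSupersolution.add_mem_posPoints (hk : RealLevyKernel k)
    (hu : RealSupersolution k Ω u) {A : Set (Euc N)} {α ε : ℝ} (hA : JumpSet k A α ε)
    {y z : Euc N} (hy : y ∈ posPoints Ω u) (hz : z ∈ A) (hyz : y + z ∈ Ω) :
    y + z ∈ posPoints Ω u := by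
  obtain ⟨hyΩ, r, hr, a, ha, h⟩ := hy
  obtain ⟨t, ht, htΩ⟩ := Metric.isOpen_iff.1 hu.isOpen y hyΩ
  have hzε := hA.le_norm z hz
  have hε := hA.eps_pos
  set s := min (min r t) (ε / 2) with hs
  have hs0 : 0 < s := by positivity
  have hsr : s ≤ r := (min_le_left _ _).trans (min_le_left _ _)
  have hst : s ≤ t := (min_le_left _ _).trans (min_le_right _ _)
  -- Jumps have length at least `ε`, so `y + z` stays off the closed ball of radius `s` about `y`,
  -- as the barrier requires.
  have hsε : s ≤ ε / 2 := min_le_right _ _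
  have hMm : MeasurableSet (Metric.ball y s ∩ {x | a ≤ u x}) :=
    measurableSet_ball.inter (measurableSet_le measurable_const hu.measurable)
  refine hu.mem_posPoints_of_jump hk hA hMm ?_ ?_ ha (fun x hx => hx.2) hyz ?_ ?_
  · exact ((measure_mono inter_subset_left).trans_lt measure_ball_lt_top).ne
  · exact fun x hx => htΩ (Metric.ball_subset_ball hst hx.1)
  · intro hcl
    have := closure_minimal (inter_subset_left.trans Metric.ball_subset_closedBall)
      Metric.isClosed_closedBall hcl
    rw [Metric.mem_closedBall, dist_eq_norm, add_sub_cancel_left] at this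
    linarith
  · have hpos := hA.support z hz s hs0
    rw [ae_restrict_iff' measurableSet_ball, ae_iff] at h
    intro h0
    have hmp := Measure.measurePreserving_sub_left (volume : Measure (Euc N)) (y + z)
    have hmeas : MeasurableSet (A ∩ Metric.ball z s) := hA.measurableSet.inter measurableSet_ball
    rw [← hmp.measure_preimage hmeas.nullMeasurableSet] at hpos
    refine hpos.ne' (measure_mono_null (fun w hw => ?_) (measure_union_null h h0))
    have hw1 : y + z - w ∈ A := hw.1
    have hw2 : w ∈ Metric.ball y s := by
      have : y + z - w ∈ Metric.ball z s := hw.2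
      rw [Metric.mem_ball, dist_eq_norm] at this ⊢
      rwa [← norm_neg, show -(w - y) = y + z - w - z by abel]
    by_cases hau : a ≤ u w
    · exact .inr ⟨⟨hw2, hau⟩, hw1⟩
    · exact .inl fun h => hau (h (Metric.ball_subset_ball hsr hw2))

/-- A jump out of a superlevel set of `u` and a jump back: the barrier gives nothing on the
superlevel set itself, but it gives positivity at the outer point `x`, from which the reverse jump
returns to `y`. -/
theorem RealSupersolution.exists_posPoint_near (hk : RealLevyKernel k)
    (hu : RealSupersolution k Ω u) {A : Set (Euc N)} {α ε r ρ : ℝ} (hA : JumpSet k A α ε)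
    (hAr : A ⊆ Metric.ball 0 r) {x₀ : Euc N} (hρε : ρ ≤ ε / 2)
    (hball : Metric.ball x₀ (ρ + r) ⊆ Ω) (hr : 0 < r)
    (hpos : volume ({y | u y ≠ 0} ∩ Metric.ball x₀ ρ) ≠ 0) :
    ∃ y ∈ Metric.ball x₀ ρ, y ∈ posPoints Ω u := by
  let M : ℕ → Set (Euc N) := fun n => {y | 1 / ((n : ℝ) + 1) ≤ u y} ∩ Metric.ball x₀ ρ
  have hMm : ∀ n, MeasurableSet (M n) := fun n =>
    (measurableSet_le measurable_const hu.measurable).inter measurableSet_ball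
  have hex : ∃ n, volume (M n) ≠ 0 := by
    by_contra! h
    refine hpos (measure_mono_null (t := ⋃ n, M n) ?_ (measure_iUnion_null h))
    rintro y ⟨hy, hyρ⟩
    obtain ⟨n, hn⟩ := exists_nat_one_div_lt ((hu.nonneg y).lt_of_ne' hy)
    exact mem_iUnion.2 ⟨n, hn.le, hyρ⟩
  obtain ⟨n, hn⟩ := hex
  -- By Tonelli, `∫ |M n ∩ (x - A)| dx = |A| |M n| > 0`.
  have hx : ∃ x, volume (M n ∩ {y | x - y ∈ A}) ≠ 0 := by
    by_contra! h
    have hmp := measurePreserving_sub_prod (volume : Measure (Euc N)) (volume : Measure (Euc N))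
    have hm := hA.measurableSet.prod (hMm n)
    have h1 := hmp.measure_preimage hm.nullMeasurableSet
    rw [Measure.prod_prod] at h1
    have h2 := (Measure.measure_prod_null (μ := (volume : Measure (Euc N)))
      (ν := (volume : Measure (Euc N))) (hmp.measurable hm)).2 (.of_forall fun x => by
        rw [Pi.zero_apply]
        convert h x using 2
        ext y
        exact and_comm)
    rw [h2] at h1
    exact mul_ne_zero hA.measure_pos.ne' hn h1.symm
  obtain ⟨x, hx⟩ := hx
  obtain ⟨y, hyM, hyA⟩ := nonempty_of_measure_ne_zero hx
  have hyA' : x - y ∈ A := hyA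
  have hyρ : dist y x₀ < ρ := hyM.2
  have hxyr : dist x y < r := by simpa [dist_eq_norm] using hAr hyA'
  have hxyε : ε ≤ dist x y := by simpa [dist_eq_norm] using hA.le_norm _ hyA'
  have hxP : x ∈ posPoints Ω u := by
    refine hu.mem_posPoints_of_jump hk hA (hMm n)
      ((measure_mono inter_subset_right).trans_lt measure_ball_lt_top).ne
      (fun w hw => hball (Metric.ball_subset_ball (by linarith) hw.2))
      (δ := 1 / ((n : ℝ) + 1)) (by positivity) (fun w hw => hw.1) (hball ?_) ?_ hx
    · rw [Metric.mem_ball]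
      linarith [dist_triangle x y x₀]
    · intro hcl
      have := closure_minimal (inter_subset_right.trans Metric.ball_subset_closedBall)
        Metric.isClosed_closedBall hcl
      rw [Metric.mem_closedBall] at this
      linarith [dist_triangle_right x y x₀]
  refine ⟨y, hyM.2, ?_⟩
  have hyΩ : y ∈ Ω := hball (Metric.ball_subset_ball (by linarith) hyM.2)
  have := hu.add_mem_posPoints hk (hA.neg hk) hxP (z := y - x) (by simpa using hyA')
    (by rwa [add_sub_cancel])
  rwa [add_sub_cancel] at this

theorem RealSupersolution.subset_union [Nontrivial (Euc N)] (hk : RealLevyKernel k)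
    (hk0 : ∀ r, 0 < r → volume ({z | 0 < k z} ∩ Metric.ball 0 r) ≠ 0)
    (hu : RealSupersolution k Ω u) : Ω ⊆ posPoints Ω u ∪ nullPoints Ω u := by
  intro x₀ hx₀
  by_contra hcon
  rw [mem_union, not_or] at hcon
  have hS : ∀ ρ, 0 < ρ → volume ({y | u y ≠ 0} ∩ Metric.ball x₀ ρ) ≠ 0 := fun ρ hρ h =>
    hcon.2 ⟨hx₀, ρ, hρ, h⟩
  obtain ⟨t, ht, htΩ⟩ := Metric.isOpen_iff.1 hu.isOpen x₀ hx₀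
  obtain ⟨A, α, ε, hAr, hA⟩ := exists_jumpSet hk.measurable (hk0 (t / 2) (by positivity))
  have hε := hA.eps_pos
  have hst : A - A ∈ 𝓝 (0 : Euc N) :=
    Measure.sub_mem_nhds_zero_of_addHaar_pos volume A hA.measurableSet hA.measure_pos
  obtain ⟨η, hη, hηA⟩ := Metric.mem_nhds_iff.1 hst
  -- `η` puts `x₀ - y` in `A - A`, `ε / 2` lets jumps leave the ball of radius `ρ`, and `t / 2`
  -- keeps the intermediate points in `Ω`.
  set ρ := min (min η (ε / 2)) (t / 2) with hρ
  have hρ0 : 0 < ρ := by positivity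
  have hρt : ρ ≤ t / 2 := min_le_right _ _
  obtain ⟨y, hy, hyP⟩ := hu.exists_posPoint_near hk hA hAr (ρ := ρ)
    ((min_le_left _ _).trans (min_le_right _ _))
    ((Metric.ball_subset_ball (by linarith)).trans htΩ) (by positivity) (hS ρ hρ0)
  have hy' : dist y x₀ < ρ := hy
  have hmem : x₀ - y ∈ A - A := hηA (by
    rw [mem_ball_zero_iff, ← dist_eq_norm, dist_comm]
    exact hy'.trans_le ((min_le_left _ _).trans (min_le_left _ _)))
  obtain ⟨z, hz, z', hz', hzz⟩ := hmem
  have hzr : ‖z‖ < t / 2 := by simpa using hAr hz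
  have h1 : y + z ∈ posPoints Ω u := hu.add_mem_posPoints hk hA hyP hz (htΩ (by
    rw [Metric.mem_ball, dist_eq_norm]
    rw [dist_eq_norm] at hy'
    calc ‖y + z - x₀‖ = ‖(y - x₀) + z‖ := by congr 1; abel
      _ ≤ _ := norm_add_le _ _
      _ < t := by linarith))
  have hzz' : z - z' = x₀ - y := hzz
  have hx₀eq : y + z + -z' = x₀ := by
    rw [add_assoc, ← sub_eq_add_neg, hzz', add_sub_cancel]
  have h2 := hu.add_mem_posPoints hk (hA.neg hk) h1 (z := -z') (by simpa using hz')
    (by rwa [hx₀eq])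
  rw [hx₀eq] at h2
  exact hcon.1 h2

/-- Strong maximum principle for everywhere measurable data. -/
theorem RealSupersolution.null_or_pos [Nontrivial (Euc N)] (hk : RealLevyKernel k)
    (hk0 : ∀ r, 0 < r → volume ({z | 0 < k z} ∩ Metric.ball 0 r) ≠ 0)
    (hu : RealSupersolution k Ω u) (hΩ : IsPreconnected Ω) :
    (∀ᵐ x ∂(volume.restrict Ω), u x = 0) ∨
      ∀ K, IsCompact K → K ⊆ Ω → ∃ a, 0 < a ∧ ∀ᵐ x ∂(volume.restrict K), a ≤ u x := by
  have hsub := hu.subset_union hk hk0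
  have hPo := isOpen_posPoints (u := u) hu.isOpen
  have hZo := isOpen_nullPoints (u := u) hu.isOpen
  by_cases hne : (Ω ∩ posPoints Ω u).Nonempty
  · right
    have hΩP := hΩ.subset_left_of_subset_union hPo hZo disjoint_posPoints_nullPoints hsub hne
    intro K hK hKΩ
    refine hK.induction_on (p := fun s => ∃ a, 0 < a ∧ ∀ᵐ x ∂(volume.restrict s), a ≤ u x)
      ⟨1, one_pos, by simp⟩ ?_ ?_ ?_
    · rintro s t hst ⟨a, ha, h⟩
      exact ⟨a, ha, ae_restrict_of_ae_restrict_of_subset hst h⟩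
    · rintro s t ⟨a, ha, h⟩ ⟨b, hb, h'⟩
      refine ⟨min a b, lt_min ha hb, ?_⟩
      rw [ae_restrict_union_iff]
      exact ⟨h.mono fun x hx => (min_le_left _ _).trans hx,
        h'.mono fun x hx => (min_le_right _ _).trans hx⟩
    · intro x hx
      obtain ⟨-, r, hr, a, ha, h⟩ := hΩP (hKΩ hx)
      exact ⟨_, mem_nhdsWithin_of_mem_nhds (Metric.ball_mem_nhds x hr), a, ha, h⟩
  · left
    have hnull : volume ({x | u x ≠ 0} ∩ Ω) = 0 := by
      refine measure_null_of_locally_null _ fun x hx => ?_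
      rcases hsub hx.2 with h | ⟨-, r, hr, h⟩
      · exact (hne ⟨x, hx.2, h⟩).elim
      · refine ⟨({x | u x ≠ 0} ∩ Ω) ∩ Metric.ball x r, Filter.inter_mem self_mem_nhdsWithin
          (mem_nhdsWithin_of_mem_nhds (Metric.ball_mem_nhds x hr)), ?_⟩
        exact measure_mono_null (inter_subset_inter_left _ inter_subset_left) h
    rw [ae_restrict_iff' hu.isOpen.measurableSet, ae_iff]
    refine measure_mono_null (fun x hx => ?_) hnull
    have hx' : ¬ (x ∈ Ω → u x = 0) := hx
    push Not at hx'
    exact ⟨hx'.2, hx'.1⟩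

end RegionalSMP

/-! ### Reduction to measurable representatives and conclusion -/

namespace RegionalSMP

variable {N : ℕ}

theorem LevyKernel.exists_real [Nontrivial (Euc N)] {j : Euc N → ℝ≥0∞} (hj : LevyKernel j) :
    ∃ k : Euc N → ℝ, RealLevyKernel k ∧ ∀ᵐ z, j z = ENNReal.ofReal (k z) := by
  let m := hj.aemeasurable.mk j
  have hm : Measurable m := hj.aemeasurable.measurable_mk
  have hjm : ∀ᵐ z, j z = m z := hj.aemeasurable.ae_eq_mk
  have hjm' : ∀ᵐ z, j z = m (-z) := by
    have := (Measure.measurePreserving_neg (volume : Measure (Euc N))).quasiMeasurePreserving.ae hjm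
    filter_upwards [this] with z hz
    rw [← hz, hj.even]
  have hfin : ∀ᵐ z, j z < ⊤ := by
    have hmeas : AEMeasurable fun z => ENNReal.ofReal (min 1 (‖z‖ ^ 2)) * j z := by
      refine AEMeasurable.mul ?_ hj.aemeasurable
      exact (by fun_prop : Measurable fun z : Euc N =>
        ENNReal.ofReal (min 1 (‖z‖ ^ 2))).aemeasurable
    have h0 : ∀ᵐ z : Euc N, z ≠ 0 := by
      rw [ae_iff]; simp
    filter_upwards [ae_lt_top' hmeas hj.integrability.ne, h0] with z hz hz0
    refine lt_top_iff_ne_top.2 fun htop => hz.ne ?_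
    rw [htop, ENNReal.mul_top]
    rw [Ne, ENNReal.ofReal_eq_zero, not_le]
    have := norm_pos_iff.2 hz0
    positivity
  -- The maximum makes the measurable version even everywhere; it still agrees with `j` a.e. because
  -- `j` is even and a.e. finite.
  let k : Euc N → ℝ := fun z => max (m z).toReal (m (-z)).toReal
  have hjk : ∀ᵐ z, j z = ENNReal.ofReal (k z) := by
    filter_upwards [hjm, hjm', hfin] with z h1 h2 h3
    simp only [k]
    rw [← h1, ← h2, max_self, ENNReal.ofReal_toReal h3.ne]
  have hkm : Measurable k := hm.ennreal_toReal.max (hm.comp measurable_neg).ennreal_toReal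
  have hk0 : ∀ z, 0 ≤ k z := fun z => le_max_of_le_left ENNReal.toReal_nonneg
  refine ⟨k, ⟨hkm, hk0, fun z => ?_, ?_, ?_⟩, hjk⟩
  · simp only [k, neg_neg]; exact max_comm _ _
  · exact (Measurable.mul (by fun_prop) hkm).aestronglyMeasurable
  · rw [hasFiniteIntegral_iff_ofReal (.of_forall fun z => mul_nonneg (by positivity) (hk0 z))]
    refine lt_of_eq_of_lt (lintegral_congr_ae ?_) hj.integrability
    filter_upwards [hjk] with z hz
    rw [hz, ENNReal.ofReal_mul (by positivity)]

theorem MemL2LocClosure.exists_measurable {Ω : Set (Euc N)} {u : Euc N → ℝ}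
    (hu : MemL2LocClosure Ω u) (hu0 : ∀ᵐ x ∂(volume.restrict Ω), 0 ≤ u x) :
    ∃ v : Euc N → ℝ, Measurable v ∧ (∀ x, 0 ≤ v x) ∧ ∀ᵐ x ∂(volume.restrict Ω), u x = v x := by
  have hm : AEMeasurable u (volume.restrict Ω) := by
    have h : ∀ n : ℕ, AEMeasurable u (volume.restrict (Metric.closedBall 0 n ∩ Ω)) := fun n =>
      (hu _ (isCompact_closedBall 0 _)).aestronglyMeasurable.aemeasurable
    have h' := AEMeasurable.iUnion h
    rwa [← iUnion_inter, Metric.iUnion_closedBall_nat, univ_inter] at h'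
  refine ⟨fun x => max (hm.mk u x) 0, hm.measurable_mk.max measurable_const,
    fun x => le_max_right _ _, ?_⟩
  filter_upwards [hm.ae_eq_mk, hu0] with x h1 h2
  rw [← h1, max_eq_left h2]

theorem ae_prod_of_ae_restrict {S T Ω : Set (Euc N)} (hS : S ⊆ Ω) (hT : T ⊆ Ω)
    {P : Euc N → Prop} (hP : ∀ᵐ x ∂(volume.restrict Ω), P x) :
    ∀ᵐ p ∂((volume : Measure (Euc N × Euc N)).restrict (S ×ˢ T)), P p.1 ∧ P p.2 := by
  rw [Measure.volume_eq_prod, ← Measure.prod_restrict]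
  exact (Measure.quasiMeasurePreserving_fst.ae (ae_restrict_of_ae_restrict_of_subset hS hP)).and
    (Measure.quasiMeasurePreserving_snd.ae (ae_restrict_of_ae_restrict_of_subset hT hP))

theorem ae_kernel_sub {j : Euc N → ℝ≥0∞} {k : Euc N → ℝ}
    (hjk : ∀ᵐ z, j z = ENNReal.ofReal (k z)) :
    ∀ᵐ p : Euc N × Euc N, j (p.1 - p.2) = ENNReal.ofReal (k (p.1 - p.2)) :=
  (quasiMeasurePreserving_sub (volume : Measure (Euc N)) (volume : Measure (Euc N))).ae hjk

theorem realSupersolution_of_weak {j : Euc N → ℝ≥0∞} {Ω : Set (Euc N)} (hΩ : IsOpen Ω)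
    {c u : Euc N → ℝ} (hc : MemLinftyLoc Ω c) (hu : MemHLoc j Ω u)
    (hsuper : IsRegionalWeakSupersolution j Ω c u) {k v : Euc N → ℝ} (hk : RealLevyKernel k)
    (hjk : ∀ᵐ z, j z = ENNReal.ofReal (k z)) (hvm : Measurable v) (hv0 : ∀ x, 0 ≤ v x)
    (huv : ∀ᵐ x ∂(volume.restrict Ω), u x = v x) : RealSupersolution k Ω v := by
  have hL2 : ∀ K, IsCompact K → K ⊆ Ω → MemLp v 2 (volume.restrict K) := fun K hK hKΩ => by
    have := hu.memL2Loc K hK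
    rw [inter_eq_left.2 hKΩ] at this
    exact (memLp_congr_ae (ae_restrict_of_ae_restrict_of_subset hKΩ huv)).1 this
  refine ⟨hΩ, hvm, hv0, hL2, fun K hK hKΩ => ?_, fun K hK hKΩ => ?_⟩
  · have hwm := measurable_wdiff hk.measurable hvm
    have hen := hu.energy_lt_top K hK.measurableSet
      ⟨by rwa [hK.isClosed.closure_eq], by rwa [hK.isClosed.closure_eq, hΩ.interior_eq]⟩
    rw [memLp_two_iff_integrable_sq hwm.aestronglyMeasurable]
    refine ⟨(hwm.pow_const 2).aestronglyMeasurable, ?_⟩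
    rw [hasFiniteIntegral_iff_ofReal (.of_forall fun p => sq_nonneg _)]
    refine lt_of_eq_of_lt (lintegral_congr_ae ?_) hen
    filter_upwards [ae_prod_of_ae_restrict hKΩ subset_rfl huv,
      ae_restrict_of_ae (ae_kernel_sub hjk)] with p h1 h2
    rw [h2, h1.1, h1.2, ← ENNReal.ofReal_mul (sq_nonneg _), pow_two, wdiff_mul_wdiff hk.nonneg,
      ← pow_two]
  · have hcK := hc K hK hKΩ
    -- On `K` one has `c ≥ -C` a.e., and `v φ ≥ 0`, so `c` may be replaced by the constant `-C`.
    set C := (eLpNorm c ⊤ (volume.restrict K)).toReal with hC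
    have hcC : ∀ᵐ x ∂(volume.restrict K), ‖c x‖ ≤ C := by
      have := ae_le_eLpNormEssSup (f := c) (μ := volume.restrict K)
      filter_upwards [this] with x hx
      rw [← eLpNorm_exponent_top] at hx
      have := ENNReal.toReal_mono hcK.2.ne hx
      rwa [toReal_enorm] at this
    refine ⟨C, ENNReal.toReal_nonneg, fun φ hφ hφK => ?_⟩
    have h := hsuper φ hφ
    have hform : regionalForm j Ω u φ = ∫ p in Ω ×ˢ Ω, wdiff k v p * wdiff k φ p := by
      refine integral_congr_ae ?_
      filter_upwards [ae_prod_of_ae_restrict subset_rfl subset_rfl huv,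
        ae_restrict_of_ae (ae_kernel_sub hjk)] with p h1 h2
      rw [h2, h1.1, h1.2, wdiff_mul_wdiff hk.nonneg, ENNReal.toReal_ofReal (hk.nonneg _)]
    rw [hform] at h
    refine le_trans ?_ h
    have hφ0 : ∀ x ∉ K, φ x = 0 := fun x hx => image_eq_zero_of_notMem_tsupport fun h => hx (hφK h)
    have e1 : ∫ x in Ω, v x * φ x = ∫ x in K, v x * φ x :=
      setIntegral_eq_of_subset_of_forall_sdiff_eq_zero hΩ.measurableSet hKΩ
        fun x hx => by rw [hφ0 x hx.2, mul_zero]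
    have e2 : ∫ x in Ω, c x * u x * φ x = ∫ x in K, c x * (v x * φ x) := by
      rw [setIntegral_eq_of_subset_of_forall_sdiff_eq_zero hΩ.measurableSet hKΩ
        fun x hx => by rw [hφ0 x hx.2, mul_zero]]
      refine integral_congr_ae ?_
      filter_upwards [ae_restrict_of_ae_restrict_of_subset hKΩ huv] with x hx
      rw [hx, mul_assoc]
    rw [e1, e2, ← integral_const_mul]
    have : IsFiniteMeasure (volume.restrict K) := ⟨by
      rw [Measure.restrict_apply_univ]; exact hK.measure_lt_top⟩
    have hvφ : Integrable (fun x => v x * φ x) (volume.restrict K) := by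
      obtain ⟨B, hB⟩ := hφ.hasCompactSupport.exists_bound_of_continuous hφ.smooth.continuous
      exact ((hL2 K hK hKΩ).integrable (by norm_num)).mul_bdd
        hφ.smooth.continuous.aestronglyMeasurable (.of_forall hB)
    refine integral_mono_ae (hvφ.const_mul _) (hvφ.bdd_mul hcK.1 hcC) ?_
    filter_upwards [hcC] with x hx
    exact mul_le_mul_of_nonneg_right (abs_le.1 hx).1 (mul_nonneg (hv0 x) (hφ.nonneg x))

end RegionalSMP
theorem mainTheorem2 (N : ℕ) (hN : 1 ≤ N)
    (j : EuclideanSpace ℝ (Fin N) → ℝ≥0∞)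
    (hj1 : RegionalSMP.LevyKernel j) (hj2 : RegionalSMP.NontrivialNearZero j)
    (Ω : Set (EuclideanSpace ℝ (Fin N))) (hΩ_open : IsOpen Ω) (hΩ_conn : IsConnected Ω)
    (c : EuclideanSpace ℝ (Fin N) → ℝ) (hc : RegionalSMP.MemLinftyLoc Ω c)
    (u : EuclideanSpace ℝ (Fin N) → ℝ) (hu : RegionalSMP.MemHLoc j Ω u)
    (hsuper : RegionalSMP.IsRegionalWeakSupersolution j Ω c u)
    (hu_nonneg : ∀ᵐ x ∂(volume.restrict Ω), 0 ≤ u x) :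
    (∀ᵐ x ∂(volume.restrict Ω), u x = 0) ∨ RegionalSMP.StrictlyPositive Ω u := by
  have : Nonempty (Fin N) := ⟨⟨0, hN⟩⟩
  have : Nontrivial (EuclideanSpace ℝ (Fin N)) := inferInstance
  obtain ⟨k, hk, hjk⟩ := hj1.exists_real
  obtain ⟨v, hvm, hv0, huv⟩ := hu.memL2Loc.exists_measurable hu_nonneg
  have hv := RegionalSMP.realSupersolution_of_weak hΩ_open hc hu hsuper hk hjk hvm hv0 huv
  have hk0 : ∀ r, 0 < r → volume ({z | 0 < k z} ∩ Metric.ball 0 r) ≠ 0 := by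
    intro r hr h0
    refine hj2 r hr ?_
    rw [ae_restrict_iff' measurableSet_ball]
    have h0' : ∀ᵐ z, z ∉ {z | 0 < k z} ∩ Metric.ball 0 r := measure_eq_zero_iff_ae_notMem.1 h0
    filter_upwards [hjk, h0'] with z h1 h2 hz
    rw [h1, ENNReal.ofReal_eq_zero]
    by_contra! h
    exact h2 ⟨h, hz⟩
  rcases hv.null_or_pos hk hk0 hΩ_conn.isPreconnected with h | h
  · left
    filter_upwards [h, huv] with x h1 h2
    rw [h2, h1]
  · right
    intro K hK hKΩ
    obtain ⟨a, ha, hKa⟩ := h K hK hKΩ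
    refine lt_of_lt_of_le (EReal.coe_pos.2 ha) (le_essInf_of_ae_le _ ?_)
    filter_upwards [hKa, ae_restrict_of_ae_restrict_of_subset hKΩ huv] with x h1 h2
    rw [h2]
    exact EReal.coe_le_coe_iff.2 h1
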